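/- **Model.** Given nonnegative weights $(w_u)_{u\in L}$ and $(w_v)_{v\in R}$ on finite sets with $|L|=n_L$, $|R|=n_R$ and $\sum_{z\in R}w_z>0$, let $G_b$ be the random bipartite graph on $L\sqcup R$ in which the pairs $(u,v)\in L\times R$ are edges independently, with probability $\min\bigl(w_uw_v/\sum_{z\in R}w_z,\,1\bigr)$. The projected graph $G=(L,E)$ joins two distinct left nodes if and only if they have a common neighbour in $G_b$. Write $M_{Lk}=\frac1{n_L}\sum_{u\in L}w_u^k$ and $M_{Rk}=\frac1{n_R}\sum_{v\in R}w_v^k$. The global clustering coefficient (transitivity) of $G$ is the conditional probability $$C_G=\mathbb P\bigl((v,w)\in E \,\bigm|\, (u,v)\in E,\ (u,w)\in E\bigr),$$ where $(u,v,w)$ is a uniformly random ordered triple of distinct left nodes, independent of $G_b$, and the weight sequences are given (conditioned on). **Theorem.** Consider a family of such weight sequences $S_L,S_R$ with $n_L,n_R\to\infty$ (at any relative rate). Assume that for some $\delta>1/10$ $$\max S_L=O(n_R^{1/2-\delta}),\quad \max S_R=O(n_R^{1/2-\delta}),\quad \min S_L=\Omega(1),\quad M_{R2}=O(M_{R1}^2),\quad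 M_{R4}=O(n_R^{1-2\delta}),$$ and that no single left node carries a non-negligible part of the left weight, i.e. $\max S_L=o(n_LM_{L1})$. Then the event conditioned on in $C_G$ has positive probability for all sufficiently large $n_L,n_R$, and $$C_G=\frac{1}{1+\frac{M_{R2}^2}{M_{R3}M_{R1}}\cdot\frac{M_{L2}}{M_{L1}}}+o(1).$$ In particular, $C_G$ stays bounded away from zero (that is, $C_G\ge c$ eventually, for some constant $c>0$) if and only if $\frac{M_{R2}^2}{M_{R3}M_{R1}}\cdot\frac{M_{L2}}{M_{L1}}=O(1)$. -/

import Mathlib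

open Filter Topology MeasureTheory

noncomputable section

namespace BipartiteProjection

/-- The `k`-th moment `(1 / n) * ∑ w_u ^ k` of a weight sequence of length `n`. -/
def moment {n : ℕ} (k : ℕ) (w : Fin n → ℝ) : ℝ :=
  (∑ u, w u ^ k) / n

/-- The probability `min (w_u w_v / ∑_{z ∈ R} w_z, 1)` that the left node `u` and the right node `v`
are joined in the bipartite graph. -/
def edgeProb {nL nR : ℕ} (wL : Fin nL → ℝ) (wR : Fin nR → ℝ) (u : Fin nL) (v : Fin nR) : ℝ :=
  min (wL u * wR v / ∑ z, wR z) 1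

/-- The law of the random bipartite graph with left nodes `Fin nL` and right nodes `Fin nR`: the
pairs `(u, v)` are edges (value `true`) independently, with probability `edgeProb wL wR u v`.
For nonnegative weights `edgeProb` lies in `[0, 1]`, so that the projection `Set.projIcc` onto the
unit interval leaves it unchanged. -/
def bipartiteLaw {nL nR : ℕ} (wL : Fin nL → ℝ) (wR : Fin nR → ℝ) :
    Measure (Fin nL × Fin nR → Bool) :=
  Measure.pi fun e : Fin nL × Fin nR =>
    ProbabilityTheory.bernoulliMeasure true false
      (Set.projIcc (0 : ℝ) 1 zero_le_one (edgeProb wL wR e.1 e.2))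

/-- The projection of a bipartite graph onto its left nodes: two distinct left nodes are adjacent
if and only if they have a common right neighbour. -/
def projection {nL nR : ℕ} (Eb : Fin nL × Fin nR → Bool) : SimpleGraph (Fin nL) where
  Adj u v := u ≠ v ∧ ∃ z, Eb (u, z) = true ∧ Eb (v, z) = true
  symm := ⟨fun _ _ h => ⟨h.1.symm, h.2.imp fun _ hz => hz.symm⟩⟩
  loopless := ⟨fun _ h => h.1 rfl⟩

/-- The ordered triples `(u, v, w)` of pairwise distinct left nodes. -/
def distinctTriples (nL : ℕ) : Set (Fin nL × Fin nL × Fin nL) :=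
  {t | t.1 ≠ t.2.1 ∧ t.1 ≠ t.2.2 ∧ t.2.1 ≠ t.2.2}

/-- The joint law of the random bipartite graph and of an independent, uniformly random triple of
distinct left nodes. -/
def jointLaw {nL nR : ℕ} (wL : Fin nL → ℝ) (wR : Fin nR → ℝ) :
    Measure ((Fin nL × Fin nR → Bool) × (Fin nL × Fin nL × Fin nL)) :=
  (bipartiteLaw wL wR).prod (ProbabilityTheory.uniformOn (distinctTriples nL))

/-- The event that `(u, v)` and `(u, w)` are edges of the projected graph, that is, that the
triple `(u, v, w)` is a wedge with center `u`. -/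
def wedgeEvent (nL nR : ℕ) : Set ((Fin nL × Fin nR → Bool) × (Fin nL × Fin nL × Fin nL)) :=
  {ω | (projection ω.1).Adj ω.2.1 ω.2.2.1 ∧ (projection ω.1).Adj ω.2.1 ω.2.2.2}

/-- The event that `(v, w)` is an edge of the projected graph. -/
def closingEvent (nL nR : ℕ) : Set ((Fin nL × Fin nR → Bool) × (Fin nL × Fin nL × Fin nL)) :=
  {ω | (projection ω.1).Adj ω.2.2.1 ω.2.2.2}

/-- The global clustering coefficient `C_G = ℙ((v, w) ∈ E ∣ (u, v), (u, w) ∈ E)` of the projected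
graph, for given weight sequences. -/
def globalClustering {nL nR : ℕ} (wL : Fin nL → ℝ) (wR : Fin nR → ℝ) : ℝ :=
  (ProbabilityTheory.cond (jointLaw wL wR) (wedgeEvent nL nR)).real (closingEvent nL nR)

/-- The quantity `(M_{R2}² / (M_{R3} M_{R1})) * (M_{L2} / M_{L1})`. -/
def weightRatio {nL nR : ℕ} (wL : Fin nL → ℝ) (wR : Fin nR → ℝ) : ℝ :=
  moment 2 wR ^ 2 / (moment 3 wR * moment 1 wR) * (moment 2 wL / moment 1 wL)

/-- The bounded-weight assumption with parameter `δ`, for a family of weight sequences indexed by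
`ι`, in the limit along the filter `l`. -/
structure BoundedWeights {ι : Type*} (l : Filter ι) (nL nR : ι → ℕ)
    (wL : ∀ i, Fin (nL i) → ℝ) (wR : ∀ i, Fin (nR i) → ℝ) (δ : ℝ) : Prop where
  max_left : ∃ C : ℝ, ∀ᶠ i in l, ∀ u, wL i u ≤ C * (nR i : ℝ) ^ (1 / 2 - δ)
  max_right : ∃ C : ℝ, ∀ᶠ i in l, ∀ v, wR i v ≤ C * (nR i : ℝ) ^ (1 / 2 - δ)
  min_left : ∃ c : ℝ, 0 < c ∧ ∀ᶠ i in l, ∀ u, c ≤ wL i u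
  moment_two : (fun i => moment 2 (wR i)) =O[l] fun i => moment 1 (wR i) ^ 2
  moment_four : (fun i => moment 4 (wR i)) =O[l] fun i => (nR i : ℝ) ^ (1 - 2 * δ)

end BipartiteProjection

end

/-! Two left nodes rarely share even one right neighbour: eventually the expected number of common
neighbours is uniformly at most `η ^ 2`, and then every edge probability is at most `η`, so the
truncation at `1` is inactive. Hence a wedge `(u, v, w)` essentially arises in two ways: one right
node joined to all three (a claw, which also closes the triangle), or two different right nodes
serving `u, v` and `u, w`. A triangle not coming from a claw needs a third independent coincidence
and is negligible against wedges.

Thus `P(wedge) ≈ claw + cherry * cherry` and `P(triangle) ≈ claw`, up to relative errors of order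
`η`. Without truncation these means are products of weights, so summing over triples gives `a / (a +
b)` with `b / a = weightRatio`; repeated nodes cost little because no left weight dominates. The
two-sided bounds are `measureReal_wedgeSet_le`, `le_measureReal_wedgeSet`,
`le_measureReal_triangleSet` and `measureReal_triangleSet_le`; `globalClustering_estimate` combines
them into a non-asymptotic error `32 * η`. -/

noncomputable section

namespace BipartiteProjection

/-! ### Independence, and pointwise bounds on the wedge and triangle indicators by counts of
witnesses. -/

section Law

variable {nL nR : ℕ} {wL : Fin nL → ℝ} {wR : Fin nR → ℝ}

instance isProbabilityMeasure_bipartiteLaw : IsProbabilityMeasure (bipartiteLaw wL wR) := by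
  unfold bipartiteLaw; infer_instance

lemma edgeProb_nonneg (hL : ∀ u, 0 ≤ wL u) (hR : ∀ v, 0 ≤ wR v) (u : Fin nL) (v : Fin nR) :
    0 ≤ edgeProb wL wR u v :=
  le_min (div_nonneg (mul_nonneg (hL u) (hR v)) (Finset.sum_nonneg fun z _ => hR z)) zero_le_one

lemma edgeProb_le_one (u : Fin nL) (v : Fin nR) : edgeProb wL wR u v ≤ 1 := min_le_right _ _

/-- The indicator of the event that all the pairs of `F` are edges. -/
def edgesIndicator (F : Finset (Fin nL × Fin nR)) (ω : Fin nL × Fin nR → Bool) : ℝ :=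
  if ∀ e ∈ F, ω e = true then 1 else 0

/-- The union counts a shared pair once; this is why two cherries meeting at the same right node
contribute three edge factors and not four. -/
lemma edgesIndicator_mul (F G : Finset (Fin nL × Fin nR)) (ω : Fin nL × Fin nR → Bool) :
    edgesIndicator F ω * edgesIndicator G ω = edgesIndicator (F ∪ G) ω := by
  simp only [edgesIndicator, Finset.mem_union, or_imp, forall_and, ite_and]
  split_ifs <;> simp

lemma integral_edgesIndicator (hL : ∀ u, 0 ≤ wL u) (hR : ∀ v, 0 ≤ wR v)
    (F : Finset (Fin nL × Fin nR)) :
    ∫ ω, edgesIndicator F ω ∂bipartiteLaw wL wR = ∏ e ∈ F, edgeProb wL wR e.1 e.2 := by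
  classical
  have h : ∀ ω : Fin nL × Fin nR → Bool, edgesIndicator F ω =
      ∏ e, (if e ∈ F then (if ω e = true then (1 : ℝ) else 0) else 1) := by
    intro ω
    rw [edgesIndicator, Finset.prod_ite_mem, Finset.univ_inter]
    by_cases H : ∀ e ∈ F, ω e = true
    · rw [if_pos H, Finset.prod_eq_one]
      intro e he
      simp [H e he]
    · rw [if_neg H]
      push Not at H
      obtain ⟨e, he, hne⟩ := H
      exact (Finset.prod_eq_zero he (by simp [hne])).symm
  simp_rw [h]
  rw [bipartiteLaw, integral_fintype_prod_eq_prod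
    (f := fun e (b : Bool) => if e ∈ F then (if b = true then (1 : ℝ) else 0) else 1)]
  simp_rw [ProbabilityTheory.integral_bernoulliMeasure]
  rw [← Finset.univ_inter F, ← Finset.prod_ite_mem]
  refine Finset.prod_congr rfl fun e _ => ?_
  have := Set.projIcc_of_mem zero_le_one
    (show edgeProb wL wR e.1 e.2 ∈ Set.Icc (0 : ℝ) 1 from
      ⟨edgeProb_nonneg hL hR _ _, edgeProb_le_one _ _⟩)
  rw [this]
  by_cases he : e ∈ F <;> simp [he]

lemma sum_ite_card {n : ℕ} (P : Fin n → Prop) [DecidablePred P] :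
    ∑ z, (if P z then (1 : ℝ) else 0) = ((Finset.univ.filter P).card : ℝ) := by
  simp

/-- For indicators this counts ordered pairs of different witnesses, `m ^ 2 - m`, the second-order
term of the Bonferroni-type bounds below. -/
lemma sum_sum_ne_eq_sq_sub {n : ℕ} (a : Fin n → ℝ) (ha : ∀ z, a z * a z = a z) :
    ∑ z, ∑ z', (if z = z' then 0 else a z * a z') = (∑ z, a z) ^ 2 - ∑ z, a z := by
  have : ∀ z z', (if z = z' then 0 else a z * a z') =
      a z * a z' - if z = z' then a z else 0 := by
    intro z z'
    split_ifs with h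
    · subst h; rw [ha]; ring
    · ring
  simp_rw [this, Finset.sum_sub_distrib, ← Finset.mul_sum, ← Finset.sum_mul]
  simp [sq]

lemma edgesIndicator_mul_self (F : Finset (Fin nL × Fin nR)) (ω : Fin nL × Fin nR → Bool) :
    edgesIndicator F ω * edgesIndicator F ω = edgesIndicator F ω := by
  rw [edgesIndicator_mul, Finset.union_self]

lemma edgesIndicator_nonneg (F : Finset (Fin nL × Fin nR)) (ω : Fin nL × Fin nR → Bool) :
    0 ≤ edgesIndicator F ω := by
  unfold edgesIndicator; split_ifs <;> norm_num

lemma exists_natCast_eq_sum_edgesIndicator (F : Fin nR → Finset (Fin nL × Fin nR))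
    (ω : Fin nL × Fin nR → Bool) :
    ∃ m : ℕ, ∑ z, edgesIndicator (F z) ω = m ∧ (m ≠ 0 ↔ ∃ z, ∀ e ∈ F z, ω e = true) := by
  refine ⟨_, sum_ite_card _, ?_⟩
  rw [Finset.card_ne_zero, Finset.filter_nonempty_iff]
  simp

/-- The pairs joining the left nodes `u` and `v` to the right node `z`. -/
def cherry (u v : Fin nL) (z : Fin nR) : Finset (Fin nL × Fin nR) := {(u, z), (v, z)}

/-- The pairs joining the left nodes `u`, `v` and `w` to the right node `z`. -/
def claw (u v w : Fin nL) (z : Fin nR) : Finset (Fin nL × Fin nR) := {(u, z), (v, z), (w, z)}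

lemma projection_adj_iff {u v : Fin nL} (h : u ≠ v) (ω : Fin nL × Fin nR → Bool) :
    (projection ω).Adj u v ↔ ∃ z, ∀ e ∈ cherry u v z, ω e = true := by
  simp [projection, cherry, h]

/-- The left nodes `v` and `w` are both adjacent to `u`. -/
def wedgeSet (nR : ℕ) {nL : ℕ} (u v w : Fin nL) : Set (Fin nL × Fin nR → Bool) :=
  {ω | (projection ω).Adj u v ∧ (projection ω).Adj u w}

/-- The left nodes `u`, `v` and `w` are pairwise adjacent. -/
def triangleSet (nR : ℕ) {nL : ℕ} (u v w : Fin nL) : Set (Fin nL × Fin nR → Bool) :=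
  {ω | ((projection ω).Adj u v ∧ (projection ω).Adj u w) ∧ (projection ω).Adj v w}

lemma indicator_wedgeSet_le {u v w : Fin nL} (huv : u ≠ v) (huw : u ≠ w)
    (ω : Fin nL × Fin nR → Bool) :
    (wedgeSet nR u v w).indicator 1 ω ≤
      ∑ z, ∑ z', edgesIndicator (cherry u v z) ω * edgesIndicator (cherry u w z') ω := by
  rw [← Finset.sum_mul_sum]
  obtain ⟨m, hm, hm'⟩ := exists_natCast_eq_sum_edgesIndicator (cherry u v) ω
  obtain ⟨n, hn, hn'⟩ := exists_natCast_eq_sum_edgesIndicator (cherry u w) ω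
  rw [hm, hn]
  by_cases h : ω ∈ wedgeSet nR u v w
  · rw [Set.indicator_of_mem h, Pi.one_apply]
    rw [wedgeSet, Set.mem_ofPred_eq, projection_adj_iff huv, projection_adj_iff huw, ← hm',
      ← hn'] at h
    exact_mod_cast Nat.one_le_iff_ne_zero.2 (mul_ne_zero h.1 h.2)
  · rw [Set.indicator_of_notMem h]
    positivity

/-- With `m` and `n` common neighbours of the two pairs, the left side is `m * n * (3 - m - n)`: it
is `1` at `m = n = 1`, zero if `m * n = 0`, and nonpositive otherwise. -/
lemma le_indicator_wedgeSet {u v w : Fin nL} (huv : u ≠ v) (huw : u ≠ w)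
    (ω : Fin nL × Fin nR → Bool) :
    ∑ z, ∑ z', edgesIndicator (cherry u v z) ω * edgesIndicator (cherry u w z') ω
      - ∑ y, ∑ z, ∑ z', (if z = z' then 0 else edgesIndicator (cherry u v z) ω *
          edgesIndicator (cherry u v z') ω) * edgesIndicator (cherry u w y) ω
      - ∑ y, ∑ z, ∑ z', (if z = z' then 0 else edgesIndicator (cherry u w z) ω *
          edgesIndicator (cherry u w z') ω) * edgesIndicator (cherry u v y) ω ≤
      (wedgeSet nR u v w).indicator 1 ω := by
  simp_rw [← Finset.sum_mul]
  rw [sum_sum_ne_eq_sq_sub _ fun z => edgesIndicator_mul_self _ ω,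
    sum_sum_ne_eq_sq_sub _ fun z => edgesIndicator_mul_self _ ω, ← Finset.sum_mul_sum,
    ← Finset.mul_sum, ← Finset.mul_sum]
  obtain ⟨m, hm, hm'⟩ := exists_natCast_eq_sum_edgesIndicator (cherry u v) ω
  obtain ⟨n, hn, hn'⟩ := exists_natCast_eq_sum_edgesIndicator (cherry u w) ω
  rw [hm, hn]
  have hbound : (m : ℝ) * n - (m ^ 2 - m) * n - (n ^ 2 - n) * m = m * n * (3 - m - n) := by ring
  rw [hbound]
  by_cases h : ω ∈ wedgeSet nR u v w
  · rw [Set.indicator_of_mem h]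
    rw [wedgeSet, Set.mem_ofPred_eq, projection_adj_iff huv, projection_adj_iff huw, ← hm',
      ← hn'] at h
    by_cases h1 : m + n = 2
    · have : m = 1 ∧ n = 1 := by omega
      rw [this.1, this.2]; norm_num
    · have h3 : 3 ≤ m + n := by omega
      have h3' : (3 : ℝ) ≤ m + n := by exact_mod_cast h3
      exact le_trans (mul_nonpos_of_nonneg_of_nonpos (by positivity) (by linarith)) zero_le_one
  · rw [Set.indicator_of_notMem h]
    rw [wedgeSet, Set.mem_ofPred_eq, projection_adj_iff huv, projection_adj_iff huw, ← hm',
      ← hn'] at h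
    have : m * n = 0 := by
      rw [Nat.mul_eq_zero]; tauto
    have : (m : ℝ) * n = 0 := by exact_mod_cast this
    rw [this, zero_mul]

/-- Counting only triangles that come from a claw, the left side is `m * (2 - m)`, which is at most
`1` and is positive only for `m = 1`. -/
lemma le_indicator_triangleSet {u v w : Fin nL} (huv : u ≠ v) (huw : u ≠ w) (hvw : v ≠ w)
    (ω : Fin nL × Fin nR → Bool) :
    ∑ z, edgesIndicator (claw u v w z) ω
      - ∑ z, ∑ z', (if z = z' then 0 else edgesIndicator (claw u v w z) ω *
          edgesIndicator (claw u v w z') ω) ≤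
      (triangleSet nR u v w).indicator 1 ω := by
  rw [sum_sum_ne_eq_sq_sub _ fun z => edgesIndicator_mul_self _ ω]
  obtain ⟨m, hm, hm'⟩ := exists_natCast_eq_sum_edgesIndicator (claw u v w) ω
  rw [hm]
  have hbound : (m : ℝ) - (m ^ 2 - m) = m * (2 - m) := by ring
  rw [hbound]
  rcases (by omega : m = 0 ∨ m = 1 ∨ 2 ≤ m) with h | h | h
  · rw [h]; simpa using Set.indicator_nonneg (by simp) ω
  · have : ω ∈ triangleSet nR u v w := by
      obtain ⟨z, hz⟩ := hm'.1 (by omega)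
      simp only [claw, Finset.mem_insert, Finset.mem_singleton, forall_eq_or_imp, forall_eq] at hz
      exact ⟨⟨⟨huv, z, hz.1, hz.2.1⟩, ⟨huw, z, hz.1, hz.2.2⟩⟩, ⟨hvw, z, hz.2.1, hz.2.2⟩⟩
    rw [Set.indicator_of_mem this, h]; norm_num
  · have h' : (2 : ℝ) ≤ m := by exact_mod_cast h
    exact le_trans (mul_nonpos_of_nonneg_of_nonpos (by positivity) (by linarith))
      (Set.indicator_nonneg (by simp) ω)

/-- Choose a witness for each side of the triangle. If two witnesses coincide, that right node sees
all three left nodes and is a claw; otherwise the three witnesses are distinct. -/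
lemma indicator_triangleSet_le {u v w : Fin nL} (ω : Fin nL × Fin nR → Bool) :
    (triangleSet nR u v w).indicator 1 ω ≤
      ∑ z, edgesIndicator (claw u v w z) ω + ∑ z, ∑ z', ∑ z'',
        (if z = z' ∨ z = z'' ∨ z' = z'' then 0 else edgesIndicator (cherry u v z) ω *
          edgesIndicator (cherry u w z') ω * edgesIndicator (cherry v w z'') ω) := by
  have hnn : ∀ z z' z'' : Fin nR, 0 ≤ (if z = z' ∨ z = z'' ∨ z' = z'' then 0 else
      edgesIndicator (cherry u v z) ω *
          edgesIndicator (cherry u w z') ω * edgesIndicator (cherry v w z'') ω) := by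
    intro z z' z''
    split_ifs
    · exact le_rfl
    · exact mul_nonneg (mul_nonneg (edgesIndicator_nonneg _ _) (edgesIndicator_nonneg _ _))
        (edgesIndicator_nonneg _ _)
  have hnn1 : ∀ z, 0 ≤ edgesIndicator (claw u v w z) ω := fun z => edgesIndicator_nonneg _ _
  have hs1 : 0 ≤ ∑ z, edgesIndicator (claw u v w z) ω := Finset.sum_nonneg fun z _ => hnn1 z
  have hs2 := Finset.sum_nonneg fun z (_ : z ∈ Finset.univ) => Finset.sum_nonneg
    fun z' (_ : z' ∈ Finset.univ) => Finset.sum_nonneg fun z'' (_ : z'' ∈ Finset.univ) =>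
      hnn z z' z''
  by_cases h : ω ∈ triangleSet nR u v w
  · rw [Set.indicator_of_mem h, Pi.one_apply]
    obtain ⟨⟨⟨-, z, hz⟩, ⟨-, z', hz'⟩⟩, ⟨-, z'', hz''⟩⟩ := h
    by_cases hd : z = z' ∨ z = z'' ∨ z' = z''
    · obtain ⟨y, hy⟩ : ∃ y, edgesIndicator (claw u v w y) ω = 1 := by
        rcases hd with rfl | rfl | rfl
        · exact ⟨z, by simp [edgesIndicator, claw, *]⟩
        · exact ⟨z, by simp [edgesIndicator, claw, *]⟩
        · exact ⟨z', by simp [edgesIndicator, claw, *]⟩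
      have := Finset.single_le_sum (fun z _ => hnn1 z) (Finset.mem_univ y)
      rw [hy] at this
      linarith
    · have h3 := Finset.single_le_sum (fun y _ => hnn z z' y) (Finset.mem_univ z'')
      have h2 := Finset.single_le_sum (fun x _ => Finset.sum_nonneg
        fun y (_ : y ∈ Finset.univ) => hnn z x y) (Finset.mem_univ z')
      have h1 := Finset.single_le_sum (fun t _ => Finset.sum_nonneg fun x (_ : x ∈ Finset.univ) =>
        Finset.sum_nonneg fun y (_ : y ∈ Finset.univ) => hnn t x y) (Finset.mem_univ z)
      have h0 : edgesIndicator (cherry u v z) ω *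
          edgesIndicator (cherry u w z') ω * edgesIndicator (cherry v w z'') ω = 1 := by
        simp [edgesIndicator, cherry, *]
      rw [if_neg hd, h0] at h3
      linarith
  · rw [Set.indicator_of_notMem h]
    linarith

end Law

/-! ### Wedge and triangle probabilities for a fixed triple of left nodes. -/

section Expectation

variable {nL nR : ℕ} (wL : Fin nL → ℝ) (wR : Fin nR → ℝ)

/-- The expected number of common neighbours of two distinct left nodes. -/
def cherryMean (u v : Fin nL) : ℝ := ∑ z, edgeProb wL wR u z * edgeProb wL wR v z

/-- The expected number of common neighbours of three distinct left nodes. -/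
def clawMean (u v w : Fin nL) : ℝ :=
  ∑ z, edgeProb wL wR u z * edgeProb wL wR v z * edgeProb wL wR w z

variable {wL wR}

lemma measureReal_eq_integral (S : Set (Fin nL × Fin nR → Bool)) :
    (bipartiteLaw wL wR).real S = ∫ ω, S.indicator 1 ω ∂bipartiteLaw wL wR :=
  (integral_indicator_one (Set.toFinite S).measurableSet).symm

lemma integral_cherry_mul_cherry (hL : ∀ u, 0 ≤ wL u) (hR : ∀ v, 0 ≤ wR v) {u v w : Fin nL}
    (huv : u ≠ v) (huw : u ≠ w) (hvw : v ≠ w) (z z' : Fin nR) :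
    ∫ ω, edgesIndicator (cherry u v z) ω * edgesIndicator (cherry u w z') ω ∂bipartiteLaw wL wR =
      if z = z' then edgeProb wL wR u z * edgeProb wL wR v z * edgeProb wL wR w z
      else (edgeProb wL wR u z * edgeProb wL wR v z) *
        (edgeProb wL wR u z' * edgeProb wL wR w z') := by
  simp_rw [edgesIndicator_mul, integral_edgesIndicator hL hR]
  split_ifs with h
  · subst h
    have : cherry u v z ∪ cherry u w z = {(u, z), (v, z), (w, z)} := by
      ext; simp only [cherry, Finset.mem_union, Finset.mem_insert, Finset.mem_singleton]; tauto
    rw [this, Finset.prod_insert (by simp [huv, huw]), Finset.prod_insert (by simp [hvw]),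
      Finset.prod_singleton]
    ring
  · rw [Finset.prod_union (by simp [cherry, Ne.symm h]), cherry, cherry, Finset.prod_pair (by simp [huv]),
      Finset.prod_pair (by simp [huw])]

/-- For `z ≠ z'` the witness `y` may differ from both, giving three independent cherries, or equal
one of them, giving a claw and a cherry. The bound adds all cases, which is harmless as every term
is nonnegative. -/
lemma integral_cherry_mul_cherry_mul_cherry_le (hL : ∀ u, 0 ≤ wL u) (hR : ∀ v, 0 ≤ wR v)
    {u v w : Fin nL} (huv : u ≠ v) (huw : u ≠ w) (hvw : v ≠ w) (y z z' : Fin nR) :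
    ∫ ω, (if z = z' then 0 else edgesIndicator (cherry u v z) ω *
        edgesIndicator (cherry u v z') ω) * edgesIndicator (cherry u w y) ω ∂bipartiteLaw wL wR ≤
      (edgeProb wL wR u y * edgeProb wL wR w y) * (edgeProb wL wR u z * edgeProb wL wR v z) *
          (edgeProb wL wR u z' * edgeProb wL wR v z') +
      ((if y = z then edgeProb wL wR u z * edgeProb wL wR v z * edgeProb wL wR w z *
          (edgeProb wL wR u z' * edgeProb wL wR v z') else 0) +
       (if y = z' then edgeProb wL wR u z' * edgeProb wL wR v z' * edgeProb wL wR w z' *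
          (edgeProb wL wR u z * edgeProb wL wR v z) else 0)) := by
  have hp := edgeProb_nonneg hL hR
  have h1 : 0 ≤ (edgeProb wL wR u y * edgeProb wL wR w y) *
      (edgeProb wL wR u z * edgeProb wL wR v z) *
          (edgeProb wL wR u z' * edgeProb wL wR v z') := by
    have := hp u y; have := hp w y; have := hp u z; have := hp v z; have := hp u z'
    have := hp v z'; positivity
  have h2 : 0 ≤ (if y = z then edgeProb wL wR u z * edgeProb wL wR v z * edgeProb wL wR w z *
          (edgeProb wL wR u z' * edgeProb wL wR v z') else 0) := by
    have := hp u z; have := hp v z; have := hp u z'; have := hp v z'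
    have := hp w z; have := hp w z'
    split_ifs <;> positivity
  have h3 : 0 ≤ (if y = z' then edgeProb wL wR u z' * edgeProb wL wR v z' * edgeProb wL wR w z' *
          (edgeProb wL wR u z * edgeProb wL wR v z) else 0) := by
    have := hp u z; have := hp v z; have := hp u z'; have := hp v z'
    have := hp w z; have := hp w z'
    split_ifs <;> positivity
  by_cases h : z = z'
  · simp only [h, if_true, zero_mul, integral_zero]
    subst h
    linarith
  simp only [h, if_false]
  simp_rw [edgesIndicator_mul, integral_edgesIndicator hL hR]
  by_cases hy : y = z
  · subst hy
    have : cherry u v y ∪ cherry u v z' ∪ cherry u w y =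
        {(u, y), (v, y), (w, y)} ∪ {(u, z'), (v, z')} := by
      ext; simp only [cherry, Finset.mem_union, Finset.mem_insert, Finset.mem_singleton]; tauto
    rw [this, Finset.prod_union (by simp [Ne.symm h]), Finset.prod_insert (by simp [huv, huw]),
      Finset.prod_insert (by simp [hvw]), Finset.prod_singleton, Finset.prod_pair (by simp [huv])]
    rw [if_pos rfl] at h2 ⊢
    simp only
    linarith
  by_cases hy' : y = z'
  · subst hy'
    have : cherry u v z ∪ cherry u v y ∪ cherry u w y =
        {(u, y), (v, y), (w, y)} ∪ {(u, z), (v, z)} := by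
      ext; simp only [cherry, Finset.mem_union, Finset.mem_insert, Finset.mem_singleton]; tauto
    rw [this, Finset.prod_union (by simp [h]), Finset.prod_insert (by simp [huv, huw]),
      Finset.prod_insert (by simp [hvw]), Finset.prod_singleton, Finset.prod_pair (by simp [huv])]
    rw [if_pos rfl] at h3 ⊢
    simp only
    linarith
  · rw [Finset.prod_union (by simp [cherry, hy, hy']),
      Finset.prod_union (by simp [cherry, Ne.symm h]), cherry, cherry, cherry,
      Finset.prod_pair (by simp [huv]), Finset.prod_pair (by simp [huv]),
      Finset.prod_pair (by simp [huw])]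
    simp only
    linarith

lemma integral_claw (hL : ∀ u, 0 ≤ wL u) (hR : ∀ v, 0 ≤ wR v) {u v w : Fin nL}
    (huv : u ≠ v) (huw : u ≠ w) (hvw : v ≠ w) (z : Fin nR) :
    ∫ ω, edgesIndicator (claw u v w z) ω ∂bipartiteLaw wL wR =
      edgeProb wL wR u z * edgeProb wL wR v z * edgeProb wL wR w z := by
  rw [integral_edgesIndicator hL hR, claw, Finset.prod_insert (by simp [huv, huw]),
      Finset.prod_insert (by simp [hvw]), Finset.prod_singleton]
  ring

/-- One factor, the edge `(w, z')`, is dropped so that the sum over `z'` becomes a `cherryMean`. -/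
lemma integral_claw_mul_claw_le (hL : ∀ u, 0 ≤ wL u) (hR : ∀ v, 0 ≤ wR v) {u v w : Fin nL}
    (huv : u ≠ v) (huw : u ≠ w) (hvw : v ≠ w) (z z' : Fin nR) :
    ∫ ω, (if z = z' then 0 else edgesIndicator (claw u v w z) ω * edgesIndicator (claw u v w z') ω)
        ∂bipartiteLaw wL wR ≤
      (edgeProb wL wR u z * edgeProb wL wR v z * edgeProb wL wR w z) *
        (edgeProb wL wR u z' * edgeProb wL wR v z') := by
  have := edgeProb_nonneg hL hR u z
  have := edgeProb_nonneg hL hR v z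
  have := edgeProb_nonneg hL hR w z
  have := edgeProb_nonneg hL hR u z'
  have := edgeProb_nonneg hL hR v z'
  split_ifs with h
  · rw [integral_zero]; positivity
  · simp_rw [edgesIndicator_mul, integral_edgesIndicator hL hR]
    have hsub : ({(u, z), (v, z), (w, z), (u, z'), (v, z')} : Finset (Fin nL × Fin nR)) ⊆
        claw u v w z ∪ claw u v w z' := by
      intro e
      simp only [claw, Finset.mem_union, Finset.mem_insert, Finset.mem_singleton]; tauto
    refine (Finset.prod_le_prod_of_subset_of_le_one hsub
      (fun e _ => edgeProb_nonneg hL hR _ _) (fun e _ _ => edgeProb_le_one _ _)).trans_eq ?_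
    rw [Finset.prod_insert (by simp [huv, huw, h]), Finset.prod_insert (by simp [hvw, h]),
      Finset.prod_insert (by simp [h]), Finset.prod_pair (by simp [huv])]
    ring

lemma integral_triangle_cherries_le (hL : ∀ u, 0 ≤ wL u) (hR : ∀ v, 0 ≤ wR v) {u v w : Fin nL}
    (huv : u ≠ v) (huw : u ≠ w) (hvw : v ≠ w) (z z' z'' : Fin nR) :
    ∫ ω, (if z = z' ∨ z = z'' ∨ z' = z'' then 0 else edgesIndicator (cherry u v z) ω *
          edgesIndicator (cherry u w z') ω * edgesIndicator (cherry v w z'') ω)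
        ∂bipartiteLaw wL wR ≤
      (edgeProb wL wR u z * edgeProb wL wR v z) * (edgeProb wL wR u z' * edgeProb wL wR w z') *
        (edgeProb wL wR v z'' * edgeProb wL wR w z'') := by
  have := edgeProb_nonneg hL hR u z
  have := edgeProb_nonneg hL hR v z
  have := edgeProb_nonneg hL hR u z'
  have := edgeProb_nonneg hL hR w z'
  have := edgeProb_nonneg hL hR v z''
  have := edgeProb_nonneg hL hR w z''
  split_ifs with h
  · rw [integral_zero]; positivity
  · push Not at h
    simp_rw [edgesIndicator_mul, integral_edgesIndicator hL hR]
    rw [Finset.prod_union (by simp [cherry, h.2.1.symm, h.2.2.symm]),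
      Finset.prod_union (by simp [cherry, h.1.symm]), cherry, cherry, cherry,
      Finset.prod_pair (by simp [huv]), Finset.prod_pair (by simp [huw]),
      Finset.prod_pair (by simp [hvw])]

lemma sum_sum_integral_cherry_mul_cherry (hL : ∀ u, 0 ≤ wL u) (hR : ∀ v, 0 ≤ wR v) {u v w : Fin nL}
    (huv : u ≠ v) (huw : u ≠ w) (hvw : v ≠ w) :
    ∑ z, ∑ z', ∫ ω, edgesIndicator (cherry u v z) ω * edgesIndicator (cherry u w z') ω
        ∂bipartiteLaw wL wR =
      clawMean wL wR u v w + cherryMean wL wR u v * cherryMean wL wR u w -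
        ∑ z, (edgeProb wL wR u z * edgeProb wL wR v z) *
          (edgeProb wL wR u z * edgeProb wL wR w z) := by
  simp_rw [integral_cherry_mul_cherry hL hR huv huw hvw]
  have : ∀ z z', (if z = z' then edgeProb wL wR u z * edgeProb wL wR v z * edgeProb wL wR w z
      else (edgeProb wL wR u z * edgeProb wL wR v z) *
        (edgeProb wL wR u z' * edgeProb wL wR w z')) =
      (if z = z' then edgeProb wL wR u z * edgeProb wL wR v z * edgeProb wL wR w z else 0) +
        (edgeProb wL wR u z * edgeProb wL wR v z) * (edgeProb wL wR u z' * edgeProb wL wR w z') -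
        (if z = z' then (edgeProb wL wR u z * edgeProb wL wR v z) *
          (edgeProb wL wR u z * edgeProb wL wR w z) else 0) := by
    intro z z'
    split_ifs with h
    · subst h; ring
    · ring
  simp_rw [this, Finset.sum_sub_distrib, Finset.sum_add_distrib]
  rw [← Finset.sum_mul_sum]
  simp [clawMean, cherryMean]

lemma sum_integral_cherry_mul_cherry_mul_cherry_le (hL : ∀ u, 0 ≤ wL u) (hR : ∀ v, 0 ≤ wR v)
    {u v w : Fin nL} (huv : u ≠ v) (huw : u ≠ w) (hvw : v ≠ w) :
    ∑ y, ∑ z, ∑ z', ∫ ω, (if z = z' then 0 else edgesIndicator (cherry u v z) ω *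
        edgesIndicator (cherry u v z') ω) * edgesIndicator (cherry u w y) ω ∂bipartiteLaw wL wR ≤
      cherryMean wL wR u w * cherryMean wL wR u v * cherryMean wL wR u v +
        2 * (clawMean wL wR u v w * cherryMean wL wR u v) := by
  refine (Finset.sum_le_sum fun y _ => Finset.sum_le_sum fun z _ => Finset.sum_le_sum fun z' _ =>
    integral_cherry_mul_cherry_mul_cherry_le hL hR huv huw hvw y z z').trans_eq ?_
  simp_rw [Finset.sum_add_distrib]
  rw [two_mul]
  congr 1
  · simp_rw [← Finset.mul_sum, ← Finset.sum_mul, ← Finset.sum_mul_sum]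
    rfl
  congr 1
  · rw [Finset.sum_comm]
    simp [clawMean, cherryMean, ← Finset.mul_sum, ← Finset.sum_mul]
  · rw [Finset.sum_comm, Finset.sum_congr rfl fun _ _ => Finset.sum_comm, Finset.sum_comm]
    simp [clawMean, cherryMean, ← Finset.mul_sum, ← Finset.sum_mul]

theorem measureReal_wedgeSet_le (hL : ∀ u, 0 ≤ wL u) (hR : ∀ v, 0 ≤ wR v) {u v w : Fin nL}
    (huv : u ≠ v) (huw : u ≠ w) (hvw : v ≠ w) :
    (bipartiteLaw wL wR).real (wedgeSet nR u v w) ≤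
      clawMean wL wR u v w + cherryMean wL wR u v * cherryMean wL wR u w := by
  rw [measureReal_eq_integral]
  refine (integral_mono .of_finite .of_finite fun ω => indicator_wedgeSet_le huv huw ω).trans ?_
  simp_rw [integral_finsetSum _ fun _ _ => Integrable.of_finite]
  rw [sum_sum_integral_cherry_mul_cherry hL hR huv huw hvw]
  have := edgeProb_nonneg hL hR
  have : 0 ≤ ∑ z, (edgeProb wL wR u z * edgeProb wL wR v z) *
          (edgeProb wL wR u z * edgeProb wL wR w z) :=
    Finset.sum_nonneg fun z _ => mul_nonneg (mul_nonneg (this _ _) (this _ _))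
      (mul_nonneg (this _ _) (this _ _))
  linarith

/-- The loss `ρ` pays for the diagonal `z = z'` of the product of cherry means, which has an extra
edge factor compared with a claw. The two second-order terms together are at most `2 * σ` times the
cherry product plus `4 * σ` times the claw mean. -/
theorem le_measureReal_wedgeSet (hL : ∀ u, 0 ≤ wL u) (hR : ∀ v, 0 ≤ wR v) {u v w : Fin nL}
    (huv : u ≠ v) (huw : u ≠ w) (hvw : v ≠ w) {ρ σ : ℝ}
    (hρ : ∀ u z, edgeProb wL wR u z ≤ ρ) (hσ : ∀ u v, cherryMean wL wR u v ≤ σ) :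
    (1 - ρ - 4 * σ) *
      (clawMean wL wR u v w + cherryMean wL wR u v * cherryMean wL wR u w) ≤
      (bipartiteLaw wL wR).real (wedgeSet nR u v w) := by
  have hp := edgeProb_nonneg hL hR
  have key := integral_mono (μ := bipartiteLaw wL wR) .of_finite .of_finite
    fun ω => le_indicator_wedgeSet (nR := nR) huv huw ω
  rw [← measureReal_eq_integral] at key
  refine le_trans ?_ key
  rw [integral_sub .of_finite .of_finite, integral_sub .of_finite .of_finite]
  simp_rw [integral_finsetSum _ fun _ _ => Integrable.of_finite]
  rw [sum_sum_integral_cherry_mul_cherry hL hR huv huw hvw]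
  have h1 := sum_integral_cherry_mul_cherry_mul_cherry_le hL hR huv huw hvw
  have h2 := sum_integral_cherry_mul_cherry_mul_cherry_le hL hR huw huv hvw.symm
  have hclaw : clawMean wL wR u w v = clawMean wL wR u v w :=
    Finset.sum_congr rfl fun z _ => by ring
  rw [hclaw] at h2
  have hT : 0 ≤ clawMean wL wR u v w := Finset.sum_nonneg fun z _ =>
    mul_nonneg (mul_nonneg (hp _ _) (hp _ _)) (hp _ _)
  have hQ : ∀ v, 0 ≤ cherryMean wL wR u v := fun v => Finset.sum_nonneg fun z _ =>
    mul_nonneg (hp _ _) (hp _ _)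
  have hD : ∑ z, (edgeProb wL wR u z * edgeProb wL wR v z) *
      (edgeProb wL wR u z * edgeProb wL wR w z) ≤ ρ * clawMean wL wR u v w := by
    rw [clawMean, Finset.mul_sum]
    refine Finset.sum_le_sum fun z _ => ?_
    calc _ = edgeProb wL wR u z *
          (edgeProb wL wR u z * edgeProb wL wR v z * edgeProb wL wR w z) := by ring
      _ ≤ _ := mul_le_mul_of_nonneg_right (hρ u z)
        (mul_nonneg (mul_nonneg (hp _ _) (hp _ _)) (hp _ _))
  generalize hT' : clawMean wL wR u v w = T at *
  have hB := mul_nonneg (hQ v) (hQ w)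
  -- A right node is needed to infer `0 ≤ ρ`; without one, all the means vanish.
  by_cases hz : Nonempty (Fin nR)
  · have hρ0 : 0 ≤ ρ := (hp u hz.some).trans (hρ u hz.some)
    nlinarith [mul_le_mul_of_nonneg_left (hσ u v) hB, mul_le_mul_of_nonneg_left (hσ u w) hB,
      mul_le_mul_of_nonneg_left (hσ u v) hT, mul_le_mul_of_nonneg_left (hσ u w) hT,
      mul_nonneg hρ0 hB, mul_nonneg ((hQ v).trans (hσ u v)) hB]
  · rw [not_nonempty_iff] at hz
    have hQ0 : ∀ v, cherryMean wL wR u v = 0 := fun v => by simp [cherryMean]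
    have hT0 : T = 0 := by rw [← hT']; simp [clawMean]
    simp [hQ0, hT0]

theorem le_measureReal_triangleSet (hL : ∀ u, 0 ≤ wL u) (hR : ∀ v, 0 ≤ wR v) {u v w : Fin nL}
    (huv : u ≠ v) (huw : u ≠ w) (hvw : v ≠ w) {σ : ℝ} (hσ : ∀ u v, cherryMean wL wR u v ≤ σ) :
    (1 - σ) * clawMean wL wR u v w ≤ (bipartiteLaw wL wR).real (triangleSet nR u v w) := by
  have hp := edgeProb_nonneg hL hR
  have key := integral_mono (μ := bipartiteLaw wL wR) .of_finite .of_finite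
    fun ω => le_indicator_triangleSet (nR := nR) huv huw hvw ω
  rw [← measureReal_eq_integral] at key
  refine le_trans ?_ key
  rw [integral_sub .of_finite .of_finite]
  simp_rw [integral_finsetSum _ fun _ _ => Integrable.of_finite, integral_claw hL hR huv huw hvw]
  have h := Finset.sum_le_sum fun z (_ : z ∈ Finset.univ) => Finset.sum_le_sum
    fun z' (_ : z' ∈ Finset.univ) => integral_claw_mul_claw_le hL hR huv huw hvw z z'
  rw [← Finset.sum_mul_sum] at h
  have hT : 0 ≤ clawMean wL wR u v w := Finset.sum_nonneg fun z _ =>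
    mul_nonneg (mul_nonneg (hp _ _) (hp _ _)) (hp _ _)
  have := mul_le_mul_of_nonneg_left (hσ u v) hT
  unfold clawMean cherryMean at *
  linarith

/-- Three distinct witnesses are independent, so the side `v, w` contributes a separate factor of at
most `σ`. -/
theorem measureReal_triangleSet_le (hL : ∀ u, 0 ≤ wL u) (hR : ∀ v, 0 ≤ wR v) {u v w : Fin nL}
    (huv : u ≠ v) (huw : u ≠ w) (hvw : v ≠ w) {σ : ℝ} (hσ : ∀ u v, cherryMean wL wR u v ≤ σ) :
    (bipartiteLaw wL wR).real (triangleSet nR u v w) ≤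
      clawMean wL wR u v w + σ * (cherryMean wL wR u v * cherryMean wL wR u w) := by
  have hp := edgeProb_nonneg hL hR
  rw [measureReal_eq_integral]
  refine (integral_mono .of_finite .of_finite fun ω => indicator_triangleSet_le ω).trans ?_
  rw [integral_add .of_finite .of_finite]
  simp_rw [integral_finsetSum _ fun _ _ => Integrable.of_finite, integral_claw hL hR huv huw hvw]
  have h := Finset.sum_le_sum fun z (_ : z ∈ Finset.univ) => Finset.sum_le_sum
    fun z' (_ : z' ∈ Finset.univ) => Finset.sum_le_sum fun z'' (_ : z'' ∈ Finset.univ) =>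
      integral_triangle_cherries_le hL hR huv huw hvw z z' z''
  simp_rw [← Finset.mul_sum, ← Finset.sum_mul, ← Finset.sum_mul_sum] at h
  have hQ : ∀ v, 0 ≤ cherryMean wL wR u v := fun v => Finset.sum_nonneg fun z _ =>
    mul_nonneg (hp _ _) (hp _ _)
  have := mul_le_mul_of_nonneg_left (hσ v w) (mul_nonneg (hQ v) (hQ w))
  unfold clawMean cherryMean at *
  linarith

end Expectation

/-! ### Averaging over triples of distinct left nodes. -/

section Joint

variable {nL nR : ℕ} {wL : Fin nL → ℝ} {wR : Fin nR → ℝ}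

/-- The ordered triples of pairwise distinct left nodes, as a `Finset`. -/
def distinctTriplesFinset (nL : ℕ) : Finset (Fin nL × Fin nL × Fin nL) :=
  Finset.univ.filter fun t => t.1 ≠ t.2.1 ∧ t.1 ≠ t.2.2 ∧ t.2.1 ≠ t.2.2

lemma coe_distinctTriplesFinset (nL : ℕ) :
    (distinctTriplesFinset nL : Set (Fin nL × Fin nL × Fin nL)) = distinctTriples nL := by
  ext t; simp [distinctTriplesFinset, distinctTriples]

lemma mem_distinctTriplesFinset {t : Fin nL × Fin nL × Fin nL} :
    t ∈ distinctTriplesFinset nL ↔ t.1 ≠ t.2.1 ∧ t.1 ≠ t.2.2 ∧ t.2.1 ≠ t.2.2 := by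
  simp [distinctTriplesFinset]

lemma jointLaw_real (S : Set ((Fin nL × Fin nR → Bool) × (Fin nL × Fin nL × Fin nL))) :
    (jointLaw wL wR).real S = (∑ t ∈ distinctTriplesFinset nL,
      (bipartiteLaw wL wR).real {ω | (ω, t) ∈ S}) / (distinctTriplesFinset nL).card := by
  have hfin : IsFiniteMeasure (ProbabilityTheory.uniformOn (distinctTriples nL)) := by
    unfold ProbabilityTheory.uniformOn; infer_instance
  rw [Measure.real, jointLaw, Measure.prod_apply_symm (Set.toFinite S).measurableSet,
    lintegral_fintype, ENNReal.toReal_sum fun t _ =>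
      ENNReal.mul_ne_top (measure_ne_top _ _) (measure_ne_top _ _)]
  rw [← coe_distinctTriplesFinset, Finset.sum_div]
  simp_rw [← Finset.coe_singleton, ProbabilityTheory.uniformOn_apply_finset]
  rw [← Finset.sum_subset (Finset.subset_univ (distinctTriplesFinset nL))]
  · refine Finset.sum_congr rfl fun t ht => ?_
    rw [Finset.inter_singleton_of_mem ht, ENNReal.toReal_mul, ENNReal.toReal_div]
    simp [Measure.real, Set.preimage, div_eq_mul_inv]
  · intro t _ ht
    simp [Finset.inter_singleton_of_notMem ht]

lemma jointLaw_real_wedgeEvent :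
    (jointLaw wL wR).real (wedgeEvent nL nR) = (∑ t ∈ distinctTriplesFinset nL,
      (bipartiteLaw wL wR).real (wedgeSet nR t.1 t.2.1 t.2.2)) /
        (distinctTriplesFinset nL).card :=
  jointLaw_real _

lemma jointLaw_real_triangle :
    (jointLaw wL wR).real (wedgeEvent nL nR ∩ closingEvent nL nR) =
      (∑ t ∈ distinctTriplesFinset nL,
        (bipartiteLaw wL wR).real (triangleSet nR t.1 t.2.1 t.2.2)) /
          (distinctTriplesFinset nL).card :=
  jointLaw_real _

lemma globalClustering_eq_div : globalClustering wL wR =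
    (∑ t ∈ distinctTriplesFinset nL,
      (bipartiteLaw wL wR).real (triangleSet nR t.1 t.2.1 t.2.2)) /
    ∑ t ∈ distinctTriplesFinset nL,
      (bipartiteLaw wL wR).real (wedgeSet nR t.1 t.2.1 t.2.2) := by
  rw [globalClustering, measureReal_def, ProbabilityTheory.cond_apply (Set.toFinite _).measurableSet,
    ENNReal.toReal_mul, ENNReal.toReal_inv, ← measureReal_def, ← measureReal_def,
    jointLaw_real_triangle, jointLaw_real_wedgeEvent]
  -- With no distinct triple, both sides are `0` by the conventions for inverse and division.
  by_cases h : ((distinctTriplesFinset nL).card : ℝ) = 0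
  · have : distinctTriplesFinset nL = ∅ := by simpa using h
    simp [this]
  · rw [inv_mul_eq_div, div_div_div_cancel_right₀ h]

lemma sum_univ_triple (a w : Fin nL → ℝ) :
    ∑ t : Fin nL × Fin nL × Fin nL, a t.1 * w t.2.1 * w t.2.2 = (∑ u, a u) * (∑ u, w u) ^ 2 := by
  simp_rw [Fintype.sum_prod_type, ← Finset.mul_sum, ← Finset.sum_mul]
  rw [← Finset.sum_mul_sum]
  ring

lemma sum_distinctTriples_le {a w : Fin nL → ℝ} (ha : ∀ u, 0 ≤ a u) (hw : ∀ u, 0 ≤ w u) :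
    ∑ t ∈ distinctTriplesFinset nL, a t.1 * w t.2.1 * w t.2.2 ≤
      (∑ u, a u) * (∑ u, w u) ^ 2 := by
  rw [← sum_univ_triple]
  exact Finset.sum_le_univ_sum_of_nonneg fun t => mul_nonneg (mul_nonneg (ha _) (hw _)) (hw _)

/-- Union bound over the three possible coincidences: identifying two coordinates replaces a full
sum of `w` by a single weight, hence keeps at most a fraction `ε` of the total. -/
lemma le_sum_distinctTriples {a w : Fin nL → ℝ} (ha : ∀ u, 0 ≤ a u) (hw : ∀ u, 0 ≤ w u) {ε : ℝ}
    (hε : ∀ u, w u ≤ ε * ∑ u', w u') :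
    (1 - 3 * ε) * ((∑ u, a u) * (∑ u, w u) ^ 2) ≤
      ∑ t ∈ distinctTriplesFinset nL, a t.1 * w t.2.1 * w t.2.2 := by
  have hnn : ∀ t : Fin nL × Fin nL × Fin nL, 0 ≤ a t.1 * w t.2.1 * w t.2.2 := fun t =>
    mul_nonneg (mul_nonneg (ha _) (hw _)) (hw _)
  have hle : ∀ t : Fin nL × Fin nL × Fin nL, a t.1 * w t.2.1 * w t.2.2
      - (if t.1 = t.2.1 then a t.1 * w t.2.1 * w t.2.2 else 0)
      - (if t.1 = t.2.2 then a t.1 * w t.2.1 * w t.2.2 else 0)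
      - (if t.2.1 = t.2.2 then a t.1 * w t.2.1 * w t.2.2 else 0) ≤
      if t.1 ≠ t.2.1 ∧ t.1 ≠ t.2.2 ∧ t.2.1 ≠ t.2.2 then a t.1 * w t.2.1 * w t.2.2 else 0 := by
    intro t
    have := hnn t
    by_cases h1 : t.1 = t.2.1
    · rw [if_pos h1, if_neg (show ¬(t.1 ≠ t.2.1 ∧ t.1 ≠ t.2.2 ∧ t.2.1 ≠ t.2.2)
        from fun h => h.1 h1)]
      split_ifs <;> linarith
    by_cases h2 : t.1 = t.2.2
    · rw [if_pos h2, if_neg (show ¬(t.1 ≠ t.2.1 ∧ t.1 ≠ t.2.2 ∧ t.2.1 ≠ t.2.2)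
        from fun h => h.2.1 h2)]
      split_ifs <;> linarith
    by_cases h3 : t.2.1 = t.2.2
    · rw [if_pos h3, if_neg (show ¬(t.1 ≠ t.2.1 ∧ t.1 ≠ t.2.2 ∧ t.2.1 ≠ t.2.2)
        from fun h => h.2.2 h3)]
      split_ifs
      linarith
    · rw [if_neg h1, if_neg h2, if_neg h3, if_pos ⟨h1, h2, h3⟩]
      linarith
  rw [distinctTriplesFinset, Finset.sum_filter]
  refine le_trans ?_ (Finset.sum_le_sum fun t _ => hle t)
  simp_rw [Finset.sum_sub_distrib]
  rw [sum_univ_triple]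
  have hA : 0 ≤ ∑ u, a u := Finset.sum_nonneg fun u _ => ha u
  have hW : 0 ≤ ∑ u, w u := Finset.sum_nonneg fun u _ => hw u
  have haw : ∑ u, a u * w u ≤ (∑ u, a u) * (ε * ∑ u, w u) := by
    rw [Finset.sum_mul]
    exact Finset.sum_le_sum fun u _ => mul_le_mul_of_nonneg_left (hε u) (ha u)
  have hww : ∑ u, w u * w u ≤ (∑ u, w u) * (ε * ∑ u, w u) := by
    rw [Finset.sum_mul]
    exact Finset.sum_le_sum fun u _ => mul_le_mul_of_nonneg_left (hε u) (hw u)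
  have e1 : ∑ t : Fin nL × Fin nL × Fin nL,
      (if t.1 = t.2.1 then a t.1 * w t.2.1 * w t.2.2 else 0) =
      (∑ u, a u * w u) * ∑ u, w u := by
    simp_rw [Fintype.sum_prod_type, Finset.sum_mul]
    refine Finset.sum_congr rfl fun u _ => ?_
    rw [Finset.sum_comm, Finset.mul_sum]
    simp
  have e2 : ∑ t : Fin nL × Fin nL × Fin nL,
      (if t.1 = t.2.2 then a t.1 * w t.2.1 * w t.2.2 else 0) =
      (∑ u, a u * w u) * ∑ u, w u := by
    simp_rw [Fintype.sum_prod_type, Finset.sum_mul]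
    refine Finset.sum_congr rfl fun u _ => ?_
    rw [Finset.mul_sum]
    refine Finset.sum_congr rfl fun v _ => ?_
    simp; ring
  have e3 : ∑ t : Fin nL × Fin nL × Fin nL,
      (if t.2.1 = t.2.2 then a t.1 * w t.2.1 * w t.2.2 else 0) =
      (∑ u, a u) * ∑ u, w u * w u := by
    simp_rw [Fintype.sum_prod_type, Finset.sum_mul]
    refine Finset.sum_congr rfl fun u _ => ?_
    rw [Finset.mul_sum]
    refine Finset.sum_congr rfl fun v _ => ?_
    simp; ring
  rw [e1, e2, e3]
  nlinarith [mul_le_mul_of_nonneg_right haw hW, mul_le_mul_of_nonneg_left hww hA]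

end Joint

/-! ### The non-asymptotic estimate of the clustering coefficient. -/

section Estimate

variable {nL nR : ℕ} {wL : Fin nL → ℝ} {wR : Fin nR → ℝ}

lemma clawMean_eq (h : ∀ u z, wL u * wR z / ∑ z', wR z' ≤ 1) (u v w : Fin nL) :
    clawMean wL wR u v w =
      (∑ z, wR z ^ 3) / (∑ z, wR z) ^ 3 * (wL u * wL v * wL w) := by
  simp_rw [clawMean, edgeProb, min_eq_left (h _ _)]
  rw [Finset.sum_div, Finset.sum_mul]
  exact Finset.sum_congr rfl fun z _ => by ring

lemma cherryMean_eq (h : ∀ u z, wL u * wR z / ∑ z', wR z' ≤ 1) (u v : Fin nL) :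
    cherryMean wL wR u v = (∑ z, wR z ^ 2) / (∑ z, wR z) ^ 2 * (wL u * wL v) := by
  simp_rw [cherryMean, edgeProb, min_eq_left (h _ _)]
  rw [Finset.sum_div, Finset.sum_mul]
  exact Finset.sum_congr rfl fun z _ => by ring

/-- Here `a` is the claw mass, `b` the two-witness mass, `t` the triangles and `s` the wedges. The
error of `t` may be relative to `b`, since only its size against `a + b` matters. -/
lemma abs_div_sub_div_le {a b θ t s : ℝ} (ha : 0 < a) (hb : 0 ≤ b) (hθ0 : 0 ≤ θ)
    (hθ : θ ≤ 1 / 2) (ht : (1 - θ) * a ≤ t) (ht' : t ≤ a + θ * b) (hs : (1 - θ) * (a + b) ≤ s)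
    (hs' : s ≤ a + b) : |t / s - a / (a + b)| ≤ 4 * θ := by
  have hab : 0 < a + b := by linarith
  have hspos : 0 < s := lt_of_lt_of_le (mul_pos (by linarith) hab) hs
  have hx : a / (a + b) ≤ 1 := (div_le_one hab).2 (by linarith)
  have hx0 : 0 ≤ a / (a + b) := by positivity
  have hxa : a / (a + b) * (a + b) = a := div_mul_cancel₀ _ hab.ne'
  generalize a / (a + b) = x at *
  have hbx : b = (1 - x) * (a + b) := by linear_combination hxa
  rw [abs_le]
  constructor
  · have : x - 4 * θ ≤ t / s := by
      rw [le_div_iff₀ hspos]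
      rcases le_total (x - 4 * θ) 0 with h | h
      · exact (mul_nonpos_of_nonpos_of_nonneg h hspos.le).trans
          ((mul_nonneg (by linarith) ha.le).trans ht)
      · calc (x - 4 * θ) * s ≤ (x - 4 * θ) * (a + b) := mul_le_mul_of_nonneg_left hs' h
          _ ≤ (1 - θ) * a := by nlinarith [mul_nonneg hθ0 hab.le, mul_nonneg hθ0 hb]
          _ ≤ t := ht
    linarith
  · have : t / s ≤ x + 4 * θ := by
      rw [div_le_iff₀ hspos]
      calc t ≤ a + θ * b := ht'
        _ = (x + θ * (1 - x)) * (a + b) := by rw [add_mul, hxa, mul_assoc, ← hbx]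
        _ ≤ ((x + 4 * θ) * (1 - θ)) * (a + b) := by
          refine mul_le_mul_of_nonneg_right ?_ hab.le
          nlinarith [mul_nonneg hθ0 hx0, mul_nonneg hθ0 (sub_nonneg.2 hθ)]
        _ = (x + 4 * θ) * ((1 - θ) * (a + b)) := by ring
        _ ≤ (x + 4 * θ) * s := mul_le_mul_of_nonneg_left hs (by positivity)
    linarith

lemma sum_pow_pos {n : ℕ} {w : Fin n → ℝ} (hw : ∀ z, 0 ≤ w z) (hpos : 0 < ∑ z, w z) (k : ℕ) :
    0 < ∑ z, w z ^ k := by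
  obtain ⟨z, hz, hz'⟩ := Finset.exists_lt_of_sum_lt
    (show ∑ z : Fin n, (0 : ℝ) < ∑ z, w z by simpa using hpos)
  exact Finset.sum_pos' (fun z _ => pow_nonneg (hw z) k) ⟨z, hz, pow_pos hz' k⟩

lemma weightRatio_eq (hR : 0 < nR) (hL : 0 < nL) : weightRatio wL wR =
    (∑ z, wR z ^ 2) ^ 2 / ((∑ z, wR z ^ 3) * ∑ z, wR z) * ((∑ u, wL u ^ 2) / ∑ u, wL u) := by
  have hR' : (nR : ℝ) ≠ 0 := by positivity
  have hL' : (nL : ℝ) ≠ 0 := by positivity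
  simp only [weightRatio, moment, pow_one]
  rw [div_pow, div_mul_div_comm (_ : ℝ) (nR : ℝ), ← sq (nR : ℝ),
    div_div_div_cancel_right₀ (pow_ne_zero 2 hR'), div_div_div_cancel_right₀ hL']

theorem globalClustering_estimate (hL : ∀ u, 0 ≤ wL u) (hR : ∀ v, 0 ≤ wR v)
    (hLpos : 0 < ∑ u, wL u) (hRpos : 0 < ∑ z, wR z) {η : ℝ} (hη : 0 < η) (hη' : η ≤ 1 / 16)
    (hcherry : ∀ u v, (∑ z, wR z ^ 2) / (∑ z, wR z) ^ 2 * (wL u * wL v) ≤ η ^ 2)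
    (hsmall : ∀ u, wL u ≤ η * ∑ u', wL u') :
    jointLaw wL wR (wedgeEvent nL nR) ≠ 0 ∧
      |globalClustering wL wR - 1 / (1 + weightRatio wL wR)| ≤ 32 * η := by
  have hraw : ∀ u z, wL u * wR z / ∑ z', wR z' ≤ η := by
    -- The square of this ratio is a single term of the cherry bound taken at `v = u`; hence the
    -- scale `η ^ 2` there.
    intro u z
    refine abs_le_of_sq_le_sq' ?_ hη.le |>.2
    refine le_trans ?_ (hcherry u u)
    have : wR z ^ 2 ≤ ∑ z, wR z ^ 2 :=
      Finset.single_le_sum (fun z _ => sq_nonneg (wR z)) (Finset.mem_univ z)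
    calc _ = wR z ^ 2 / (∑ z, wR z) ^ 2 * (wL u * wL u) := by ring
      _ ≤ _ := mul_le_mul_of_nonneg_right (div_le_div_of_nonneg_right this (by positivity))
        (mul_self_nonneg _)
  have hraw1 : ∀ u z, wL u * wR z / ∑ z', wR z' ≤ 1 := fun u z => (hraw u z).trans (by linarith)
  have hρ : ∀ u z, edgeProb wL wR u z ≤ η := fun u z => (min_le_left _ _).trans (hraw u z)
  have hσ : ∀ u v, cherryMean wL wR u v ≤ η ^ 2 := fun u v => by
    rw [cherryMean_eq hraw1]; exact hcherry u v
  have hSL2 := sum_pow_pos hL hLpos 2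
  have hSR2 := sum_pow_pos hR hRpos 2
  have hSR3 := sum_pow_pos hR hRpos 3
  set W := ∑ z, wR z
  set A := (∑ z, wR z ^ 3) / W ^ 3 with hA
  set B := ((∑ z, wR z ^ 2) / W ^ 2) ^ 2 with hB
  have hApos : 0 < A := by positivity
  have hBpos : 0 < B := by positivity
  have hclaw : ∀ t : Fin nL × Fin nL × Fin nL, clawMean wL wR t.1 t.2.1 t.2.2 =
      A * (wL t.1 * wL t.2.1 * wL t.2.2) := fun t => clawMean_eq hraw1 _ _ _
  have hcc : ∀ t : Fin nL × Fin nL × Fin nL,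
      cherryMean wL wR t.1 t.2.1 * cherryMean wL wR t.1 t.2.2 =
      B * (wL t.1 ^ 2 * wL t.2.1 * wL t.2.2) := fun t => by
    rw [cherryMean_eq hraw1, cherryMean_eq hraw1]; ring
  have hD1 := sum_distinctTriples_le hL hL
  have hD1' := le_sum_distinctTriples hL hL hsmall
  have hD2 := sum_distinctTriples_le (fun u => sq_nonneg (wL u)) hL
  have hD2' := le_sum_distinctTriples (fun u => sq_nonneg (wL u)) hL hsmall
  set D1 := ∑ t ∈ distinctTriplesFinset nL, wL t.1 * wL t.2.1 * wL t.2.2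
  set D2 := ∑ t ∈ distinctTriplesFinset nL, wL t.1 ^ 2 * wL t.2.1 * wL t.2.2
  set t := ∑ t ∈ distinctTriplesFinset nL,
      (bipartiteLaw wL wR).real (triangleSet nR t.1 t.2.1 t.2.2)
  set s := ∑ t ∈ distinctTriplesFinset nL,
      (bipartiteLaw wL wR).real (wedgeSet nR t.1 t.2.1 t.2.2)
  have hs' : s ≤ A * D1 + B * D2 := by
    rw [Finset.mul_sum, Finset.mul_sum, ← Finset.sum_add_distrib]
    refine Finset.sum_le_sum fun t ht => ?_
    rw [mem_distinctTriplesFinset] at ht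
    rw [← hclaw, ← hcc]
    exact measureReal_wedgeSet_le hL hR ht.1 ht.2.1 ht.2.2
  have hs : (1 - η - 4 * η ^ 2) * (A * D1 + B * D2) ≤ s := by
    rw [Finset.mul_sum, Finset.mul_sum, ← Finset.sum_add_distrib, Finset.mul_sum]
    refine Finset.sum_le_sum fun t ht => ?_
    rw [mem_distinctTriplesFinset] at ht
    rw [← hclaw, ← hcc]
    exact le_measureReal_wedgeSet hL hR ht.1 ht.2.1 ht.2.2 hρ hσ
  have ht : (1 - η ^ 2) * (A * D1) ≤ t := by
    rw [Finset.mul_sum, Finset.mul_sum]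
    refine Finset.sum_le_sum fun t ht => ?_
    rw [mem_distinctTriplesFinset] at ht
    rw [← hclaw]
    exact le_measureReal_triangleSet hL hR ht.1 ht.2.1 ht.2.2 hσ
  have ht' : t ≤ A * D1 + η ^ 2 * (B * D2) := by
    rw [Finset.mul_sum, Finset.mul_sum, Finset.mul_sum, ← Finset.sum_add_distrib]
    refine Finset.sum_le_sum fun t ht => ?_
    rw [mem_distinctTriplesFinset] at ht
    rw [← hclaw, ← hcc]
    exact measureReal_triangleSet_le hL hR ht.1 ht.2.1 ht.2.2 hσ
  set SL := ∑ u, wL u with hSL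
  set a := A * (SL * SL ^ 2) with ha
  set b := B * ((∑ u, wL u ^ 2) * SL ^ 2) with hb
  have hapos : 0 < a := by positivity
  have hbpos : 0 < b := by positivity
  have h1 : A * D1 ≤ a := mul_le_mul_of_nonneg_left hD1 hApos.le
  have h2 : B * D2 ≤ b := mul_le_mul_of_nonneg_left hD2 hBpos.le
  have h1' : (1 - 3 * η) * a ≤ A * D1 := by
    have := mul_le_mul_of_nonneg_left hD1' hApos.le
    linarith
  have h2' : (1 - 3 * η) * b ≤ B * D2 := by
    have := mul_le_mul_of_nonneg_left hD2' hBpos.le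
    linarith
  -- Absorbs second-order terms, so that all relative errors fit under `θ = 8 * η`; then `η ≤ 1 /
  -- 16` gives `θ ≤ 1 / 2` and `4 * θ = 32 * η`.
  have hη2 : η ^ 2 ≤ η / 16 := by nlinarith
  have hs1 : (1 - 8 * η) * (a + b) ≤ s := by
    calc (1 - 8 * η) * (a + b) ≤ ((1 - η - 4 * η ^ 2) * (1 - 3 * η)) * (a + b) :=
          mul_le_mul_of_nonneg_right (by nlinarith [pow_pos hη 3]) (by positivity)
      _ = (1 - η - 4 * η ^ 2) * ((1 - 3 * η) * a + (1 - 3 * η) * b) := by ring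
      _ ≤ (1 - η - 4 * η ^ 2) * (A * D1 + B * D2) :=
          mul_le_mul_of_nonneg_left (add_le_add h1' h2') (by linarith)
      _ ≤ s := hs
  have ht1 : (1 - 8 * η) * a ≤ t := by
    calc (1 - 8 * η) * a ≤ ((1 - η ^ 2) * (1 - 3 * η)) * a :=
          mul_le_mul_of_nonneg_right (by nlinarith [pow_pos hη 3]) hapos.le
      _ = (1 - η ^ 2) * ((1 - 3 * η) * a) := by ring
      _ ≤ (1 - η ^ 2) * (A * D1) := mul_le_mul_of_nonneg_left h1' (by linarith)
      _ ≤ t := ht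
  have ht1' : t ≤ a + 8 * η * b := by
    have h3 : η ^ 2 * (B * D2) ≤ η ^ 2 * b := mul_le_mul_of_nonneg_left h2 (sq_nonneg _)
    have h4 : η ^ 2 * b ≤ 8 * η * b := mul_le_mul_of_nonneg_right (by linarith) hbpos.le
    linarith
  have hnL : 0 < nL := by
    rcases Nat.eq_zero_or_pos nL with h | h
    · subst h; simp [hSL] at hLpos
    · exact h
  have hnR : 0 < nR := by
    rcases Nat.eq_zero_or_pos nR with h | h
    · subst h; simp at hSR2
    · exact h
  have hspos : 0 < s := lt_of_lt_of_le (mul_pos (by linarith) (by positivity)) hs1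
  refine ⟨fun h0 => ?_, ?_⟩
  · have h := jointLaw_real_wedgeEvent (wL := wL) (wR := wR)
    rw [Measure.real, h0, ENNReal.toReal_zero, eq_comm, div_eq_zero_iff] at h
    rcases h with h | h
    · exact hspos.ne' h
    · have : distinctTriplesFinset nL = ∅ := by simpa using h
      exact hspos.ne' (by simp [s, this])
  · have hratio : 1 / (1 + weightRatio wL wR) = a / (a + b) := by
      have : weightRatio wL wR = b / a := by
        rw [weightRatio_eq hnR hnL, ha, hb, hA, hB]
        field_simp
        exact div_self (mul_pos hRpos hLpos).ne'
      rw [this]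
      field_simp
    rw [hratio, globalClustering_eq_div]
    refine (abs_div_sub_div_le hapos hbpos.le (by positivity) (by linarith) ht1 ht1' hs1
      (hs'.trans (add_le_add h1 h2))).trans_eq (by ring)

end Estimate

end BipartiteProjection

end

/-! ### The asymptotic statement. -/

theorem mainTheorem2 {ι : Type*} (l : Filter ι) (nL nR : ι → ℕ)
    (hnL : Tendsto nL l atTop) (hnR : Tendsto nR l atTop)
    (wL : ∀ i, Fin (nL i) → ℝ) (wR : ∀ i, Fin (nR i) → ℝ)
    (hwL : ∀ i u, 0 ≤ wL i u) (hwR : ∀ i v, 0 ≤ wR i v) (hwR_pos : ∀ i, 0 < ∑ v, wR i v)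
    (δ : ℝ) (hδ : 1 / 10 < δ)
    (hbounded : BipartiteProjection.BoundedWeights l nL nR wL wR δ)
    (hnegligible : ∀ ε : ℝ, 0 < ε → ∀ᶠ i in l, ∀ u, wL i u ≤ ε * ∑ u', wL i u') :
    (∀ᶠ i in l, BipartiteProjection.jointLaw (wL i) (wR i)
        (BipartiteProjection.wedgeEvent (nL i) (nR i)) ≠ 0) ∧
    Tendsto (fun i => BipartiteProjection.globalClustering (wL i) (wR i)
        - 1 / (1 + BipartiteProjection.weightRatio (wL i) (wR i))) l (𝓝 0) ∧
    ((∃ c : ℝ, 0 < c ∧ ∀ᶠ i in l, c ≤ BipartiteProjection.globalClustering (wL i) (wR i)) ↔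
      (fun i => BipartiteProjection.weightRatio (wL i) (wR i)) =O[l] fun _ => (1 : ℝ)) := by
  have hcherry : ∀ η : ℝ, 0 < η → ∀ᶠ i in l, ∀ u v,
      (∑ z, wR i z ^ 2) / (∑ z, wR i z) ^ 2 * (wL i u * wL i v) ≤ η ^ 2 := by
    intro η hη
    obtain ⟨C, hC⟩ := hbounded.max_left
    obtain ⟨K, hKpos, hK⟩ := hbounded.moment_two.exists_pos
    -- The second-moment assumption makes the weight factor at most `K / nR`, and the two left
    -- weights contribute at most `C ^ 2 * nR ^ (1 - 2 * δ)`; the product is this null sequence.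
    have hlim : Tendsto (fun i => K * C ^ 2 * (nR i : ℝ) ^ (-(2 * δ))) l (𝓝 0) := by
      have := ((tendsto_rpow_neg_atTop (y := 2 * δ) (by linarith)).comp
        (tendsto_natCast_atTop_atTop.comp hnR)).const_mul (K * C ^ 2)
      simpa using this
    filter_upwards [hC, hK.bound, hlim.eventually_le_const (pow_pos hη 2),
      hnR.eventually_gt_atTop 0] with i hCi hKi hi hn u v
    refine le_trans ?_ hi
    have hn' : (0 : ℝ) < nR i := by exact_mod_cast hn
    have hW := hwR_pos i
    have hS : 0 ≤ ∑ z, wR i z ^ 2 := Finset.sum_nonneg fun z _ => sq_nonneg _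
    simp only [BipartiteProjection.moment, pow_one, Real.norm_eq_abs] at hKi
    rw [abs_of_nonneg (by positivity), abs_of_nonneg (by positivity), div_pow,
      div_le_iff₀ hn'] at hKi
    have h1 : (∑ z, wR i z ^ 2) / (∑ z, wR i z) ^ 2 ≤ K / nR i := by
      rw [div_le_iff₀ (by positivity)]
      refine hKi.trans_eq ?_
      field_simp
    have h2 : wL i u * wL i v ≤ C ^ 2 * (nR i : ℝ) ^ (1 - 2 * δ) := by
      calc _ ≤ (C * (nR i : ℝ) ^ (1 / 2 - δ)) * (C * (nR i : ℝ) ^ (1 / 2 - δ)) :=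
            mul_le_mul (hCi u) (hCi v) (hwL i v) ((hwL i u).trans (hCi u))
        _ = C ^ 2 * ((nR i : ℝ) ^ (1 / 2 - δ) * (nR i : ℝ) ^ (1 / 2 - δ)) := by ring
        _ = _ := by rw [← Real.rpow_add hn']; ring_nf
    calc _ ≤ K / nR i * (C ^ 2 * (nR i : ℝ) ^ (1 - 2 * δ)) :=
          mul_le_mul h1 h2 (mul_nonneg (hwL i u) (hwL i v)) (by positivity)
      _ = K * C ^ 2 * (nR i : ℝ) ^ (-(2 * δ)) := by
        rw [sub_eq_add_neg, Real.rpow_add hn', Real.rpow_one]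
        field_simp
  have hLpos : ∀ᶠ i in l, 0 < ∑ u, wL i u := by
    obtain ⟨c, hc, hmin⟩ := hbounded.min_left
    filter_upwards [hmin, hnL.eventually_gt_atTop 0] with i hi hn
    exact Finset.sum_pos (fun u _ => hc.trans_le (hi u)) ⟨⟨0, hn⟩, Finset.mem_univ _⟩
  have key : ∀ η : ℝ, 0 < η → η ≤ 1 / 16 → ∀ᶠ i in l,
      BipartiteProjection.jointLaw (wL i) (wR i)
        (BipartiteProjection.wedgeEvent (nL i) (nR i)) ≠ 0 ∧
      |BipartiteProjection.globalClustering (wL i) (wR i)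
        - 1 / (1 + BipartiteProjection.weightRatio (wL i) (wR i))| ≤ 32 * η := by
    intro η hη hη'
    filter_upwards [hcherry η hη, hLpos, hnegligible η hη] with i h1 h2 h3
    exact BipartiteProjection.globalClustering_estimate (hwL i) (hwR i) h2 (hwR_pos i) hη hη' h1 h3
  have hlim : Tendsto (fun i => BipartiteProjection.globalClustering (wL i) (wR i)
        - 1 / (1 + BipartiteProjection.weightRatio (wL i) (wR i))) l (𝓝 0) := by
    rw [Metric.tendsto_nhds]
    intro ε hε
    -- With `ε / 64` the error is at most `ε / 2`, which gives the strict inequality.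
    filter_upwards [key (min (1 / 16) (ε / 64)) (by positivity) (min_le_left _ _)] with i hi
    rw [Real.dist_eq, sub_zero]
    have := min_le_right (1 / 16 : ℝ) (ε / 64)
    linarith [hi.2]
  have hrnn : ∀ i, 0 ≤ BipartiteProjection.weightRatio (wL i) (wR i) := by
    intro i
    have hm : ∀ {n : ℕ} (k : ℕ) (w : Fin n → ℝ), (∀ z, 0 ≤ w z) →
        0 ≤ BipartiteProjection.moment k w := fun k w hw =>
      div_nonneg (Finset.sum_nonneg fun z _ => pow_nonneg (hw z) k) (Nat.cast_nonneg _)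
    exact mul_nonneg (div_nonneg (sq_nonneg _) (mul_nonneg (hm _ _ (hwR i)) (hm _ _ (hwR i))))
      (div_nonneg (hm _ _ (hwL i)) (hm _ _ (hwL i)))
  refine ⟨(key (1 / 16) (by norm_num) le_rfl).mono fun i hi => hi.1, hlim, ?_, ?_⟩
  · rintro ⟨c, hc, hcl⟩
    -- Once the error is at most `c / 2`, one has `c / 2 ≤ 1 / (1 + r)` for the weight ratio `r`,
    -- hence `r ≤ 2 / c`.
    refine Asymptotics.IsBigO.of_bound (2 / c) ?_
    filter_upwards [hcl, hlim.eventually_le_const (half_pos hc)] with i h1 h2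
    have hr := hrnn i
    rw [Real.norm_of_nonneg hr, norm_one, mul_one, le_div_iff₀ hc]
    have h3 : c / 2 ≤ 1 / (1 + BipartiteProjection.weightRatio (wL i) (wR i)) := by linarith
    rw [le_div_iff₀ (by linarith)] at h3
    nlinarith
  · intro hO
    obtain ⟨K, hK, hb⟩ := hO.exists_pos
    -- The main term is eventually at least `1 / (1 + K)`; half of it is left for the error.
    refine ⟨1 / (1 + K) / 2, by positivity, ?_⟩
    filter_upwards [hb.bound,
      hlim.eventually_const_le (show -(1 / (1 + K) / 2) < 0 by
        have : 0 < 1 / (1 + K) / 2 := by positivity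
        linarith)] with i h1 h2
    have hr := hrnn i
    rw [Real.norm_of_nonneg hr, norm_one, mul_one] at h1
    have := one_div_le_one_div_of_le (by linarith)
      (show 1 + BipartiteProjection.weightRatio (wL i) (wR i) ≤ 1 + K by linarith)
    linarith
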